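/- Let $L\ge 1$ and let $X_1,\dots,X_L$ be independent real random variables, where $X_i$ follows the Pearson type III distribution with parameters $(a_i,b_i,m_i)$: $a_i$ is a positive integer, $b_i\neq 0$, $m_i\in\mathbb R$, and $X_i$ has the density $$f(x;a_i,b_i,m_i)=\frac{|b_i|}{\Gamma(a_i)}\,\bigl(b_i(x-m_i)\bigr)^{a_i-1}e^{-b_i(x-m_i)}$$ on $(m_i,\infty)$ if $b_i>0$ and on $(-\infty,m_i)$ if $b_i<0$ (and $0$ elsewhere). Assume that either $b_i>0$ for all $i$ or $b_i<0$ for all $i$. Put $SX_L=\sum_{i=1}^L X_i$, $sa_L=\sum_{i=1}^L a_i$ and $sm_L=\sum_{i=1}^L m_i$. For $a>0$, $b\ne0$, $m\in\mathbb R$ let $$F(x;a,b,m)=\begin{cases}\Gamma\bigl(a,b(x-m)\bigr)/\Gamma(a), & b<0,\ x<m,\\ 1, & b<0,\ x\ge m,\\ \gamma\bigl(a,b(x-m)\bigr)/\Gamma(a), & b>0,\ x>m,\\ 0, & b>0,\ x\le m,\end{cases} \qquad \mu^n(a,b,m)=\sum_{l=0}^n\binom nl\frac{m^{n-l}\,\Gamma(l+a)}{b^l\,\Gamma(a)},$$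 where $\Gamma(a,z)=\int_z^\infty t^{a-1}e^{-t}\,dt$ and $\gamma(a,z)=\int_0^z t^{a-1}e^{-t}\,dt$; these are the CDF and the $n$-th moment of the Pearson type III distribution. If the $b_i$ are pairwise distinct, define for $1\le i\le L$ and $1\le k\le a_i$ $$\Xi_L^0(i,k)=\sum_{a_i=j_0\ge j_1\ge\cdots\ge j_{L-2}\ge j_{L-1}=k}(-1)^{sa_L-a_i}\,\frac{\prod_{w=1}^L b_w^{a_w}}{b_i^{k}}\prod_{s=1}^{L-1}\frac{(j_{s-1}+a_{c(s)}-j_s-1)!}{(a_{c(s)}-1)!\,(j_{s-1}-j_s)!}\,\bigl(b_i-b_{c(s)}\bigr)^{j_s-j_{s-1}-a_{c(s)}},$$ where the sum is over integer sequences $(j_0,\dots,j_{L-1})$ with the stated endpoints, and $c(s)=s$ for $s<i$, $c(s)=s+1$ for $s\ge i$ (so $c(1),\dots,c(L-1)$ are the indices different from $i$, in increasing order). For $L=1$ this reads $\Xi_1^0(1,a_1)=1$ and $\Xi_1^0(1,k)=0$ for $k<a_1$. Then for every $x\in\mathbb R$ $$\Pr(SX_L\le x)=\begin{cases}F(x;sa_L,b,sm_L),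 & b_i=b\ \text{for all } i,\\[2pt] \displaystyle\sum_{i=1}^L\sum_{k=1}^{a_i}\Xi_L^0(i,k)\,F(x;k,b_i,sm_L), & b_i\ne b_j\ \text{for all } i\ne j,\end{cases}$$ and for every integer $n\ge0$ the $n$-th moment of $SX_L$ exists (that is, $SX_L^n$ is integrable) and $$\mathbb E\bigl[SX_L^n\bigr]=\begin{cases}\mu^n(sa_L,b,sm_L), & b_i=b\ \text{for all } i,\\[2pt] \displaystyle\sum_{i=1}^L\sum_{k=1}^{a_i}\Xi_L^0(i,k)\,\mu^n(k,b_i,sm_L), & b_i\ne b_j\ \text{for all } i\ne j.\end{cases}$$ -/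

import Mathlib

open MeasureTheory ProbabilityTheory

noncomputable section

/-- Density of the Pearson type III distribution with shape `a`, inverse scale `b` and shift `m`.
It is supported on `(m, ∞)` if `b > 0` and on `(-∞, m)` if `b < 0`, that is, where
`b * (x - m) > 0`. -/
def pearsonPDF (a b m x : ℝ) : ℝ :=
  if 0 < b * (x - m) then
    |b| / Real.Gamma a * (b * (x - m)) ^ (a - 1) * Real.exp (-(b * (x - m)))
  else 0

/-- The Pearson type III distribution with parameters `(a, b, m)`. -/
def pearsonMeasure (a b m : ℝ) : Measure ℝ :=
  volume.withDensity fun x => ENNReal.ofReal (pearsonPDF a b m x)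

/-- Lower incomplete gamma function `γ(a, z)`, for `z ≥ 0`. -/
def lowerGamma (a z : ℝ) : ℝ :=
  ∫ t in Set.Ioc 0 z, t ^ (a - 1) * Real.exp (-t)

/-- Upper incomplete gamma function `Γ(a, z)`, for `z ≥ 0`. -/
def upperGamma (a z : ℝ) : ℝ :=
  ∫ t in Set.Ioi z, t ^ (a - 1) * Real.exp (-t)

/-- The closed form `F_X(x, a, b, m)` of the Pearson type III CDF. On the support the maximum is
`b * (x - m)`; off the support it is `0`, so that the value is `0` for `b > 0`, `x ≤ m` and `1` for
`b < 0`, `x ≥ m`. -/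
def pearsonCDF (a b m x : ℝ) : ℝ :=
  if b < 0 then upperGamma a (max 0 (b * (x - m))) / Real.Gamma a
  else lowerGamma a (max 0 (b * (x - m))) / Real.Gamma a

/-- The closed form of the `n`-th moment of the Pearson type III distribution. -/
def pearsonMoment (n : ℕ) (a b m : ℝ) : ℝ :=
  ∑ l ∈ Finset.range (n + 1),
    (n.choose l : ℝ) * (m ^ (n - l) * Real.Gamma (l + a) / (b ^ l * Real.Gamma a))

/-- The summation indices of the weight `Ξ⁰` for `L = N + 1` variables: all integer sequences
`top = j 0 ≥ j 1 ≥ ⋯ ≥ j (L - 1) = k`. The free entries are `j 1, …, j (L - 2)`, so summing over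
this set is the nested sum `∑_{j₁ = k}^{top} ∑_{j₂ = k}^{j₁} ⋯ ∑_{j_{L-2} = k}^{j_{L-3}}`. -/
def descendingChains (N top k : ℕ) : Finset (Fin (N + 1) → ℕ) :=
  (Fintype.piFinset fun _ => Finset.Icc k top).filter fun j =>
    j 0 = top ∧ j (Fin.last N) = k ∧ ∀ s : Fin N, j s.succ ≤ j s.castSucc

/-- The weight `Ξ⁰_L(i, k, a, b)` for `L = N + 1` variables. As `s` runs through `0, …, L - 2`,
`i.succAbove s` runs through the indices other than `i` in increasing order: in 1-based numbering
it is `s + U(s - i)`, `U` being the Heaviside step function with `U(0) = 1`. -/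
def Xi0 {N : ℕ} (i : Fin (N + 1)) (k : ℕ) (a : Fin (N + 1) → ℕ) (b : Fin (N + 1) → ℝ) : ℝ :=
  ∑ j ∈ descendingChains N (a i) k,
    (-1) ^ ((∑ w, a w) - a i) * ((∏ w, b w ^ a w) / b i ^ k) *
      ∏ s : Fin N,
        ((j s.castSucc + a (i.succAbove s) - j s.succ - 1).factorial : ℝ) /
            (((a (i.succAbove s) - 1).factorial : ℝ) *
              ((j s.castSucc - j s.succ).factorial : ℝ)) *
          (b i - b (i.succAbove s)) ^
            ((j s.succ : ℤ) - (j s.castSucc : ℤ) - (a (i.succAbove s) : ℤ))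

end

/-! The law of the sum is identified by its characteristic function. Each `X i` is an affine image
of a standard gamma variable, so its characteristic function is `(b / (b - it)) ^ a * exp (imt)`
(`charFun_pearsonMeasure`). By independence that of the sum is a product, with shift factor `exp (it
∑ m)`. If all `b i` agree, the product is a single power, and the sum is again of Pearson type III.

If the `b i` are distinct, the rational function `∏ (b i / (b i + w)) ^ a i`, at `w = -it`, is split
into partial fractions (`prod_eq_sum_Xi0`). In the local variable `u = b i + w` the other factors
are `b c + w = -((b i - b c) - u)`, and the coefficient of `u ^ (-k)` is read off from the
expansions of `((b i - b c) - u) ^ (-a c)`. The coefficient of a product of such series is a sum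
over descending chains, which is `Xi0` (`Xi0_eq_coeff`).

So the characteristic function of the sum is a signed combination of Pearson ones, and
`integral_eq_sum_of_charFun_eq_sum` carries this over to integrals: indicators give the CDF, powers
give the moments. -/

/-! ### Power series coefficients as sums over descending chains -/

/-- The power series expansion of `(d - X)⁻ᵃ`. -/
noncomputable def invSubPow {K : Type*} [Field K] (a : ℕ) (d : K) : PowerSeries K :=
  PowerSeries.mk fun n =>
    ((n + a - 1).factorial : K) / (((a - 1).factorial : K) * (n.factorial : K)) *
      d ^ (-(n : ℤ) - (a : ℤ))

/-- Since `(d - X) ^ a = d ^ a * (1 - X / d) ^ a`, this is the negative binomial series rescaled by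
`d⁻¹`. -/
lemma invSubPow_mul {K : Type*} [Field K] [CharZero K] {a : ℕ} (ha : 0 < a) {d : K} (hd : d ≠ 0) :
    invSubPow a d * (PowerSeries.C d - PowerSeries.X) ^ a = 1 := by
  obtain ⟨a, rfl⟩ := Nat.exists_eq_succ_of_ne_zero ha.ne'
  have h := congrArg (PowerSeries.rescale d⁻¹)
    (PowerSeries.mk_add_choose_mul_one_sub_pow_eq_one K a)
  rw [map_mul, map_pow, map_sub, map_one, PowerSeries.rescale_X, PowerSeries.rescale_mk] at h
  have h1 : (PowerSeries.C d - PowerSeries.X : PowerSeries K)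
      = PowerSeries.C d * (1 - PowerSeries.C d⁻¹ * PowerSeries.X) := by
    rw [mul_sub, ← mul_assoc, ← map_mul, mul_inv_cancel₀ hd, map_one, one_mul, mul_one]
  have h2 : invSubPow (a + 1) d * PowerSeries.C (d ^ (a + 1))
      = PowerSeries.mk fun n => d⁻¹ ^ n * (Nat.choose (a + n) a : K) := by
    ext n
    rw [PowerSeries.coeff_mul_C, invSubPow, PowerSeries.coeff_mk, PowerSeries.coeff_mk,
      Nat.cast_choose K (Nat.le_add_right a n), Nat.add_sub_cancel_left, mul_assoc,
      ← zpow_natCast d (a + 1), ← zpow_add₀ hd, sub_add_cancel, zpow_neg, zpow_natCast, inv_pow,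
      mul_comm, ← Nat.add_assoc, Nat.add_sub_cancel, Nat.add_sub_cancel, Nat.add_comm n a]
  rw [Nat.succ_eq_add_one, h1, mul_pow, ← map_pow, ← mul_assoc, h2, h]

lemma sum_descendingChains_succ {M : Type*} [AddCommMonoid M] (N top k : ℕ)
    (F : (Fin (N + 2) → ℕ) → M) :
    ∑ j ∈ descendingChains (N + 1) top k, F j
      = ∑ q ∈ Finset.Icc k top, ∑ j ∈ descendingChains N q k,
          F (Fin.cons top j) := by
  rw [Finset.sum_sigma']
  refine Finset.sum_bij' (fun j _ => ⟨j 1, Fin.tail j⟩) (fun p _ => Fin.cons top p.2) ?_ ?_ ?_ ?_ ?_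
  · intro j hj
    simp only [descendingChains, Finset.mem_filter, Fintype.mem_piFinset, Finset.mem_sigma,
      Finset.mem_Icc] at hj ⊢
    obtain ⟨h1, h2, h3, h4⟩ := hj
    have hanti : Antitone j := Fin.antitone_iff_succ_le.2 h4
    refine ⟨h1 1, fun s => ⟨(h1 s.succ).1, ?_⟩, rfl, h3, fun s => h4 s.succ⟩
    exact hanti (by rw [Fin.le_def]; simp)
  · rintro ⟨q, j⟩ hj
    simp only [descendingChains, Finset.mem_filter, Fintype.mem_piFinset, Finset.mem_sigma,
      Finset.mem_Icc] at hj ⊢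
    obtain ⟨h0, h1, h2, h3, h4⟩ := hj
    refine ⟨?_, rfl, ?_, ?_⟩
    · intro s
      refine Fin.cases ?_ (fun s => ?_) s
      · simpa using h0.1.trans h0.2
      · simpa using ⟨(h1 s).1, (h1 s).2.trans h0.2⟩
    · rw [← Fin.succ_last, Fin.cons_succ, h3]
    · intro s
      refine Fin.cases ?_ (fun s => ?_) s
      · simpa [h2] using h0.2
      · rw [← Fin.succ_castSucc, Fin.cons_succ, Fin.cons_succ]
        exact h4 s
  · intro j hj
    simp only [descendingChains, Finset.mem_filter] at hj
    simp only [← hj.2.1, Fin.cons_self_tail]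
  · rintro ⟨q, j⟩ hj
    simp only [descendingChains, Finset.mem_filter, Finset.mem_sigma] at hj
    obtain ⟨-, -, rfl, -⟩ := hj
    rfl
  · intro j hj
    simp only [descendingChains, Finset.mem_filter] at hj
    simp only [← hj.2.1, Fin.cons_self_tail]

/-- A coefficient of a product of power series as a sum over descending chains. -/
lemma coeff_prod_eq_sum_descendingChains {R : Type*} [CommSemiring R] (k : ℕ) :
    ∀ (N : ℕ) (f : Fin N → PowerSeries R) (top : ℕ), k ≤ top →
      PowerSeries.coeff (top - k) (∏ s, f s)
        = ∑ j ∈ descendingChains N top k,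
            ∏ s : Fin N, PowerSeries.coeff (j s.castSucc - j s.succ) (f s)
  | 0, f, top, h => by
    have hmem : ∀ j : Fin 1 → ℕ, j ∈ descendingChains 0 top k ↔ j 0 = top ∧ j 0 = k := by
      intro j
      simp only [descendingChains, Finset.mem_filter, Fintype.mem_piFinset, Finset.mem_Icc]
      constructor
      · rintro ⟨-, h1, h2, -⟩
        exact ⟨h1, h2⟩
      · rintro ⟨h1, h2⟩
        refine ⟨fun s => ?_, h1, h2, fun s => s.elim0⟩
        rw [show s = 0 from Fin.fin_one_eq_zero s]
        omega
    rcases h.eq_or_lt with rfl | h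
    · rw [show descendingChains 0 k k = {fun _ => k} by
        ext j
        rw [hmem, Finset.mem_singleton, and_self, funext_iff, Fin.forall_fin_one]]
      simp
    · rw [show descendingChains 0 top k = ∅ by
        ext j
        rw [hmem]
        simp only [Finset.notMem_empty, iff_false]
        omega]
      simp [PowerSeries.coeff_one, (Nat.sub_pos_of_lt h).ne']
  | N + 1, f, top, h => by
    rw [sum_descendingChains_succ, Fin.prod_univ_succ, PowerSeries.coeff_mul]
    have hR : ∀ q ∈ Finset.Icc k top, (∑ j ∈ descendingChains N q k,
        ∏ s : Fin (N + 1), PowerSeries.coeff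
          ((Fin.cons top j : Fin (N + 2) → ℕ) s.castSucc - (Fin.cons top j : Fin (N + 2) → ℕ) s.succ) (f s))
        = PowerSeries.coeff (top - q) (f 0) *
          PowerSeries.coeff (q - k) (∏ s : Fin N, f s.succ) := by
      intro q hq
      rw [coeff_prod_eq_sum_descendingChains k N _ q (Finset.mem_Icc.1 hq).1, Finset.mul_sum]
      refine Finset.sum_congr rfl fun j hj => ?_
      simp only [descendingChains, Finset.mem_filter] at hj
      rw [Fin.prod_univ_succ]
      simp only [Fin.castSucc_zero, Fin.cons_zero, Fin.cons_succ, ← Fin.succ_castSucc, hj.2.1]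
    rw [Finset.sum_congr rfl hR]
    -- The second chain entry `q` corresponds to splitting the degree `top - k` as `(top - q) + (q -
    -- k)`.
    refine Finset.sum_bij' (fun p _ => k + p.2) (fun q _ => (top - q, q - k)) ?_ ?_ ?_ ?_ ?_
    · rintro ⟨p, q⟩ hp
      have := Finset.HasAntidiagonal.mem_antidiagonal.1 hp
      rw [Finset.mem_Icc]
      dsimp only at this ⊢
      omega
    · intro q hq
      rw [Finset.mem_Icc] at hq
      refine Finset.HasAntidiagonal.mem_antidiagonal.2 ?_
      dsimp only
      omega
    · rintro ⟨p, q⟩ hp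
      have := Finset.HasAntidiagonal.mem_antidiagonal.1 hp
      rw [Prod.mk.injEq]
      dsimp only at this ⊢
      omega
    · intro q hq
      simp only [Finset.mem_Icc] at hq ⊢
      omega
    · rintro ⟨p, q⟩ hp
      have := Finset.HasAntidiagonal.mem_antidiagonal.1 hp
      dsimp only at this ⊢
      congr 3 <;> omega

/-- The factor of `Xi0` at `s` is the coefficient of `invSubPow` at the gap between consecutive
chain entries, and the gaps add up to `a i - k`. -/
lemma Xi0_eq_coeff {N : ℕ} (i : Fin (N + 1)) {k : ℕ} (a : Fin (N + 1) → ℕ)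
    (b : Fin (N + 1) → ℝ) (hk : k ≤ a i) :
    Xi0 i k a b = (-1) ^ (∑ s, a (i.succAbove s)) * ((∏ w, b w ^ a w) / b i ^ k) *
      PowerSeries.coeff (a i - k)
        (∏ s, invSubPow (a (i.succAbove s)) (b i - b (i.succAbove s))) := by
  rw [coeff_prod_eq_sum_descendingChains k N _ _ hk, Finset.mul_sum, Xi0,
    Fin.sum_univ_succAbove a i, Nat.add_sub_cancel_left]
  refine Finset.sum_congr rfl fun j hj => ?_
  simp only [descendingChains, Finset.mem_filter] at hj
  congr 1
  refine Finset.prod_congr rfl fun s _ => ?_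
  have hs := hj.2.2.2 s
  rw [invSubPow, PowerSeries.coeff_mk, Nat.cast_sub hs, neg_sub, Nat.sub_add_comm hs]

/-! ### Partial fractions -/

open Polynomial in
/-- Partial fractions: `1 / ∏ (X + b i) ^ a i`, with denominators cleared. The numerator at `b i`
is the truncated expansion of the inverse of the remaining factors. -/
lemma sum_taylor_trunc_mul_prod_eq_one {K : Type*} [Field K] {N : ℕ} (a : Fin (N + 1) → ℕ)
    (ha : ∀ i, 0 < a i) (b : Fin (N + 1) → K) (hb : Function.Injective b)
    (H : Fin (N + 1) → PowerSeries K)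
    (hH : ∀ i, H i * ∏ s, (PowerSeries.X - PowerSeries.C (b i - b (i.succAbove s)))
      ^ a (i.succAbove s) = 1) :
    ∑ i, taylor (b i) ((H i).trunc (a i)) *
      ∏ s, (X + C (b (i.succAbove s))) ^ a (i.succAbove s) = 1 := by
  set R : K[X] := ∑ i, taylor (b i) ((H i).trunc (a i)) *
      ∏ s, (X + C (b (i.succAbove s))) ^ a (i.succAbove s) with hR
  have hmonic : (∏ i, (X + C (b i)) ^ a i).Monic :=
    monic_prod_of_monic _ _ fun i _ => (monic_X_add_C _).pow _
  have hdegprod : (∏ i, (X + C (b i)) ^ a i).degree = ((∑ i, a i : ℕ) : WithBot ℕ) := by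
    simp [degree_prod, degree_pow]
  -- `R - 1` has degree below `∑ a i` but is divisible by the coprime factors `(X + b i) ^ a i`, so
  -- it vanishes.
  have hdeg : (R - 1).degree < (∏ i, (X + C (b i)) ^ a i).degree := by
    rw [hdegprod]
    refine (degree_sub_le _ _).trans_lt (max_lt ?_ ?_)
    · refine (degree_sum_le _ _).trans_lt ?_
      rw [Finset.sup_lt_iff (WithBot.bot_lt_coe _)]
      intro i _
      rw [degree_mul, degree_taylor, Fin.sum_univ_succAbove a i]
      simp only [degree_prod, degree_pow, degree_X_add_C, nsmul_eq_mul, mul_one, Nat.cast_add,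
        Nat.cast_sum]
      rw [← Nat.cast_sum]
      exact WithBot.add_lt_add_right (WithBot.coe_ne_bot) (PowerSeries.degree_trunc_lt _ _)
    · rw [degree_one, Fin.sum_univ_succAbove a 0]
      have := ha 0
      exact_mod_cast (by omega : 0 < a 0 + ∑ s : Fin N, a (Fin.succAbove 0 s))
  have hdvd : ∏ i, (X + C (b i)) ^ a i ∣ R - 1 := by
    refine Fintype.prod_dvd_of_coprime ?_ ?_
    · intro i j hij
      have : IsCoprime (X - C (-b i)) (X - C (-b j)) :=
        isCoprime_X_sub_C_of_isUnit_sub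
          (sub_ne_zero.2 fun h => hij (hb (neg_injective h))).isUnit
      simpa using this.pow
    · intro i
      rw [hR, Fin.sum_univ_succAbove _ i, add_sub_right_comm]
      refine dvd_add ?_ (Finset.dvd_sum fun s _ => ?_)
      -- Modulo `X ^ a i` the truncation agrees with `H i`, the inverse of the product. The
      -- substitution `X ↦ X + b i` then gives divisibility by `(X + b i) ^ a i`.
      · have key : X ^ a i ∣ (H i).trunc (a i) *
            ∏ s, (X - C (b i - b (i.succAbove s))) ^ a (i.succAbove s) - 1 := by
          rw [X_pow_dvd_iff]
          intro d hd
          rw [coeff_sub, ← Polynomial.coeff_coe, ← Polynomial.coeff_coe, Polynomial.coe_mul,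
            PowerSeries.coeff_mul_eq_coeff_trunc_mul_trunc _ _ hd, PowerSeries.trunc_trunc,
            ← PowerSeries.coeff_mul_eq_coeff_trunc_mul_trunc _ _ hd, sub_eq_zero]
          congr 1
          rw [Polynomial.coe_one, ← hH i]
          congr 1
          rw [← Polynomial.coeToPowerSeries.ringHom_apply, map_prod]
          simp
        obtain ⟨q, hq⟩ := key
        have := congrArg (taylorAlgHom (b i)) hq
        rw [map_sub, map_mul, map_prod, map_mul, map_pow, map_one] at this
        have hcoe : ∀ p, taylorAlgHom (b i) p = taylor (b i) p := fun _ => rfl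
        simp only [hcoe, taylor_pow, map_sub, taylor_X, taylor_C] at this
        refine ⟨taylor (b i) q, ?_⟩
        rw [← this]
        congr 2
        refine Finset.prod_congr rfl fun s _ => ?_
        congr 1
        ring
      · refine Dvd.dvd.mul_left ?_ _
        obtain ⟨r, hr⟩ := Fin.exists_succAbove_eq (Fin.succAbove_ne i s).symm
        have := Finset.dvd_prod_of_mem (fun r => (X + C (b ((i.succAbove s).succAbove r)))
          ^ a ((i.succAbove s).succAbove r)) (Finset.mem_univ r)
        simpa only [hr] using this
  by_contra hne
  exact hmonic.not_dvd_of_degree_lt (sub_ne_zero.2 hne) hdeg hdvd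

open Polynomial in
lemma prod_eq_sum_Xi0 {N : ℕ} (a : Fin (N + 1) → ℕ) (ha : ∀ i, 0 < a i)
    (b : Fin (N + 1) → ℝ) (hb : ∀ i j, i ≠ j → b i ≠ b j) (hb0 : ∀ i, b i ≠ 0) (w : ℂ)
    (hw : ∀ i, (b i : ℂ) + w ≠ 0) :
    ∏ i, ((b i : ℂ) / (b i + w)) ^ a i
      = ∑ i, ∑ k ∈ Finset.Icc 1 (a i), (Xi0 i k a b : ℂ) * ((b i : ℂ) / (b i + w)) ^ k := by
  have hinj : Function.Injective b := fun i j h => by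
    by_contra hij
    exact hb i j hij h
  set H : Fin (N + 1) → PowerSeries ℝ := fun i =>
    PowerSeries.C ((-1) ^ (∑ s, a (i.succAbove s))) *
      ∏ s, invSubPow (a (i.succAbove s)) (b i - b (i.succAbove s)) with hHdef
  have hH : ∀ i, H i * ∏ s, (PowerSeries.X - PowerSeries.C (b i - b (i.succAbove s)))
      ^ a (i.succAbove s) = 1 := by
    intro i
    rw [hHdef]
    dsimp only
    -- The sign is distributed over the factors to turn each `X - d` into `d - X`.
    rw [← Finset.prod_pow_eq_pow_sum, map_prod, ← Finset.prod_mul_distrib,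
      ← Finset.prod_mul_distrib]
    refine Finset.prod_eq_one fun s _ => ?_
    rw [map_pow, map_neg, map_one, mul_right_comm, ← mul_pow, neg_one_mul, neg_sub, mul_comm]
    exact invSubPow_mul (ha _) (sub_ne_zero.2 (hb _ _ (Fin.succAbove_ne i s).symm))
  have h := congrArg (aeval w) (sum_taylor_trunc_mul_prod_eq_one a ha b hinj H hH)
  rw [map_sum, map_one] at h
  have hprod : ∏ i, ((b i : ℂ) + w) ^ a i ≠ 0 :=
    Finset.prod_ne_zero_iff.2 fun i _ => pow_ne_zero _ (hw i)
  rw [← mul_one (∏ i, ((b i : ℂ) / (b i + w)) ^ a i), ← h, Finset.mul_sum]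
  refine Finset.sum_congr rfl fun i _ => ?_
  have hT : aeval w (taylor (b i) ((H i).trunc (a i)))
      = ∑ k ∈ Finset.Icc 1 (a i), ((PowerSeries.coeff (a i - k) (H i) : ℝ) : ℂ) *
          (b i + w) ^ (a i - k) := by
    rw [taylor_apply, aeval_comp, aeval_def, PowerSeries.eval₂_trunc_eq_sum_range]
    simp only [map_add, aeval_X, aeval_C, Complex.coe_algebraMap]
    refine Finset.sum_bij' (fun n _ => a i - n) (fun k _ => a i - k) ?_ ?_ ?_ ?_ ?_
    · intro n hn; simp only [Finset.mem_range, Finset.mem_Icc] at hn ⊢; omega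
    · intro n hn; simp only [Finset.mem_range, Finset.mem_Icc] at hn ⊢; omega
    · intro n hn; simp only [Finset.mem_range] at hn ⊢; omega
    · intro n hn; simp only [Finset.mem_Icc] at hn ⊢; omega
    · intro n hn
      simp only [Finset.mem_range] at hn
      rw [Nat.sub_sub_self hn.le, add_comm w]
  rw [map_mul, hT, Finset.sum_mul, Finset.mul_sum]
  refine Finset.sum_congr rfl fun k hk => ?_
  have hk' := (Finset.mem_Icc.1 hk).2
  rw [Xi0_eq_coeff i a b hk', hHdef]
  dsimp only
  rw [PowerSeries.coeff_C_mul]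
  simp only [map_prod, map_pow, map_add, aeval_X, aeval_C, Complex.coe_algebraMap, div_pow,
    Finset.prod_div_distrib]
  rw [Fin.prod_univ_succAbove (fun i => ((b i : ℂ) + w) ^ a i) i]
  have hsplit : ((b i : ℂ) + w) ^ a i = (b i + w) ^ (a i - k) * (b i + w) ^ k := by
    rw [← pow_add, Nat.sub_add_cancel hk']
  have h3 : ∏ s, ((b (i.succAbove s) : ℂ) + w) ^ a (i.succAbove s) ≠ 0 :=
    Finset.prod_ne_zero_iff.2 fun i _ => pow_ne_zero _ (hw _)
  have h4 := hw i
  have h5 : (b i : ℂ) ≠ 0 := by exact_mod_cast hb0 i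
  rw [hsplit]
  simp only [add_comm w]
  push_cast
  field_simp

/-! ### The Pearson law as an affine image of the gamma law: moments and CDF -/

lemma pearsonMeasure_eq_map (a m : ℝ) {b : ℝ} (hb : b ≠ 0) :
    pearsonMeasure a b m = (gammaMeasure a 1).map fun y => b⁻¹ * y + m := by
  have hvol : volume = (ENNReal.ofReal |b| • volume : Measure ℝ).map fun y => b * (y - m) := by
    have h1 : (volume : Measure ℝ).map (fun y => y - m) = volume := by
      simpa only [sub_eq_add_neg] using map_add_right_eq_self (volume : Measure ℝ) (-m)
    rw [Measure.map_smul, ← Function.comp_def (fun y => b * y) (fun y => y - m),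
      ← Measure.map_map (by fun_prop) (by fun_prop), h1, Real.smul_map_volume_mul_left hb]
  have hmeas : Measurable (gammaPDF a 1) := (measurable_gammaPDFReal a 1).ennreal_ofReal
  ext s hs
  have hpre : MeasurableSet ((fun y => b⁻¹ * y + m) ⁻¹' s) :=
    (by fun_prop : Measurable fun y => b⁻¹ * y + m) hs
  rw [Measure.map_apply (by fun_prop) hs, pearsonMeasure, gammaMeasure,
    withDensity_apply _ hs, withDensity_apply _ hpre, hvol,
    setLIntegral_map hpre hmeas (by fun_prop), ← hvol, ← Set.preimage_comp,
    Measure.restrict_smul, lintegral_smul_measure, smul_eq_mul, ← lintegral_const_mul _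
      (by fun_prop : Measurable fun x => gammaPDF a 1 (b * (x - m)))]
  have hid : (fun y => b⁻¹ * y + m) ∘ (fun y => b * (y - m)) = id := by
    ext y
    simp only [Function.comp_apply, id]
    field_simp
    ring
  rw [hid, Set.preimage_id]
  refine lintegral_congr_ae (ae_restrict_of_ae ?_)
  -- The gamma density includes the endpoint `0` of its support, the Pearson density does not; they
  -- may differ at `x = m`.
  have hne : ∀ᵐ x : ℝ, x ≠ m := by simp [ae_iff]
  filter_upwards [hne] with x hx
  rw [gammaPDF, ← ENNReal.ofReal_mul (abs_nonneg b), pearsonPDF, gammaPDFReal]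
  have h0 : b * (x - m) ≠ 0 := mul_ne_zero hb (sub_ne_zero.2 hx)
  have hiff : (0 < b * (x - m)) ↔ (0 ≤ b * (x - m)) :=
    ⟨le_of_lt, fun h => lt_of_le_of_ne h h0.symm⟩
  simp only [hiff, Real.one_rpow, one_mul]
  split_ifs <;> congr 1 <;> ring

lemma isProbabilityMeasure_pearsonMeasure {a b : ℝ} (m : ℝ) (ha : 0 < a) (hb : b ≠ 0) :
    IsProbabilityMeasure (pearsonMeasure a b m) := by
  have := isProbabilityMeasure_gammaMeasure ha one_pos
  rw [pearsonMeasure_eq_map a m hb]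
  exact Measure.isProbabilityMeasure_map (by fun_prop)

lemma gammaMeasure_one_eq (a : ℝ) :
    gammaMeasure a 1 = (volume.restrict (Set.Ioi 0)).withDensity fun y =>
      ENNReal.ofReal ((Real.Gamma a)⁻¹ * (y ^ (a - 1) * Real.exp (-y))) := by
  rw [← withDensity_indicator measurableSet_Ioi, gammaMeasure]
  refine withDensity_congr_ae ?_
  have hne : ∀ᵐ x : ℝ, x ≠ 0 := by simp [ae_iff]
  filter_upwards [hne] with x hx
  rw [gammaPDF, gammaPDFReal]
  rcases lt_or_gt_of_ne hx with h | h
  · rw [if_neg (not_le.2 h), Set.indicator_of_notMem (by simpa using h.le), ENNReal.ofReal_zero]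
  · rw [if_pos h.le, Set.indicator_of_mem (by simpa using h), Real.one_rpow, one_mul, one_div,
      mul_assoc]

lemma integral_gammaMeasure_one {E : Type*} [NormedAddCommGroup E] [NormedSpace ℝ E] {a : ℝ}
    (ha : 0 < a) (f : ℝ → E) :
    ∫ y, f y ∂(gammaMeasure a 1)
      = (Real.Gamma a)⁻¹ • ∫ y in Set.Ioi 0, (y ^ (a - 1) * Real.exp (-y)) • f y := by
  rw [gammaMeasure_one_eq, integral_withDensity_eq_integral_toReal_smul₀ (by fun_prop)
    (Filter.Eventually.of_forall fun _ => ENNReal.ofReal_lt_top), ← integral_smul]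
  refine setIntegral_congr_fun measurableSet_Ioi fun y (hy : 0 < y) => ?_
  have := Real.Gamma_pos_of_pos ha
  rw [ENNReal.toReal_ofReal (by positivity), mul_smul]

lemma integrable_gammaMeasure_one_iff {E : Type*} [NormedAddCommGroup E] [NormedSpace ℝ E] {a : ℝ}
    (ha : 0 < a) {f : ℝ → E} :
    Integrable f (gammaMeasure a 1)
      ↔ IntegrableOn (fun y => (y ^ (a - 1) * Real.exp (-y)) • f y) (Set.Ioi 0) := by
  have hΓ := Real.Gamma_pos_of_pos ha
  rw [gammaMeasure_one_eq, integrable_withDensity_iff_integrable_smul₀' (by fun_prop)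
    (Filter.Eventually.of_forall fun _ => ENNReal.ofReal_lt_top), IntegrableOn,
    ← integrable_smul_iff (inv_ne_zero hΓ.ne')
      (fun y => (y ^ (a - 1) * Real.exp (-y)) • f y)]
  refine integrable_congr ((ae_restrict_iff' measurableSet_Ioi).2
    (Filter.Eventually.of_forall fun y (hy : 0 < y) => ?_))
  dsimp only [Pi.smul_apply]
  rw [ENNReal.toReal_ofReal (by positivity), mul_smul]

lemma gamma_integrand_mul_pow {a : ℝ} (l : ℕ) {y : ℝ} (hy : 0 < y) :
    (y ^ (a - 1) * Real.exp (-y)) • y ^ l = Real.exp (-y) * y ^ ((l + a) - 1) := by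
  rw [smul_eq_mul, ← Real.rpow_natCast y l, mul_right_comm, ← Real.rpow_add hy, mul_comm]
  congr 2
  ring

lemma integrable_pow_gammaMeasure_one {a : ℝ} (ha : 0 < a) (l : ℕ) :
    Integrable (fun y : ℝ => y ^ l) (gammaMeasure a 1) := by
  rw [integrable_gammaMeasure_one_iff ha]
  exact (Real.GammaIntegral_convergent (s := l + a) (by positivity)).congr_fun
    (fun y hy => (gamma_integrand_mul_pow l hy).symm) measurableSet_Ioi

lemma integral_pow_gammaMeasure_one {a : ℝ} (ha : 0 < a) (l : ℕ) :
    ∫ y, y ^ l ∂(gammaMeasure a 1) = Real.Gamma (l + a) / Real.Gamma a := by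
  rw [integral_gammaMeasure_one ha, Real.Gamma_eq_integral (s := l + a) (by positivity),
    setIntegral_congr_fun measurableSet_Ioi fun y hy => gamma_integrand_mul_pow l hy,
    smul_eq_mul, div_eq_inv_mul]

lemma integrable_affine_pow_gammaMeasure_one {a : ℝ} (ha : 0 < a) (c m : ℝ) (n : ℕ) :
    Integrable (fun y : ℝ => (c * y + m) ^ n) (gammaMeasure a 1) := by
  simp only [add_pow, mul_pow]
  refine integrable_finsetSum _ fun l _ => ?_
  exact (((integrable_pow_gammaMeasure_one ha l).const_mul _).mul_const _).mul_const _

lemma integrable_pow_pearsonMeasure {a b : ℝ} (m : ℝ) (ha : 0 < a) (hb : b ≠ 0) (n : ℕ) :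
    Integrable (fun x : ℝ => x ^ n) (pearsonMeasure a b m) := by
  rw [pearsonMeasure_eq_map a m hb, integrable_map_measure (by fun_prop) (by fun_prop)]
  exact integrable_affine_pow_gammaMeasure_one ha _ _ n

lemma integral_pow_pearsonMeasure {a b : ℝ} (m : ℝ) (ha : 0 < a) (hb : b ≠ 0) (n : ℕ) :
    ∫ x, x ^ n ∂(pearsonMeasure a b m) = pearsonMoment n a b m := by
  rw [pearsonMeasure_eq_map a m hb, integral_map (by fun_prop) (by fun_prop), pearsonMoment]
  simp only [add_pow, mul_pow]
  rw [integral_finsetSum _ fun l _ =>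
    (((integrable_pow_gammaMeasure_one ha l).const_mul _).mul_const _).mul_const _]
  refine Finset.sum_congr rfl fun l _ => ?_
  rw [integral_mul_const, integral_mul_const, integral_const_mul,
    integral_pow_gammaMeasure_one ha l, inv_pow]
  field_simp

lemma measureReal_gammaMeasure_one {a : ℝ} (ha : 0 < a) {s : Set ℝ} (hs : MeasurableSet s) :
    (gammaMeasure a 1).real s
      = (∫ y in Set.Ioi 0 ∩ s, y ^ (a - 1) * Real.exp (-y)) / Real.Gamma a := by
  rw [← integral_indicator_one hs, integral_gammaMeasure_one ha, smul_eq_mul, div_eq_inv_mul,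
    ← setIntegral_indicator hs]
  congr 2 with y
  by_cases hy : y ∈ s <;> simp [hy]

lemma measureReal_Iic_pearsonMeasure {a b : ℝ} (m : ℝ) (ha : 0 < a) (hb : b ≠ 0) (x : ℝ) :
    (pearsonMeasure a b m).real (Set.Iic x) = pearsonCDF a b m x := by
  rw [pearsonMeasure_eq_map a m hb, map_measureReal_apply (by fun_prop) measurableSet_Iic,
    pearsonCDF]
  have hiff : ∀ y, b * (b⁻¹ * y + m - x) = y - b * (x - m) := fun y => by field_simp; ring
  rcases lt_or_gt_of_ne hb with h | h
  · rw [if_pos h, upperGamma]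
    -- A negative `b` reverses the order, hence the upper incomplete gamma function.
    have hpre : (fun y => b⁻¹ * y + m) ⁻¹' Set.Iic x = Set.Ici (b * (x - m)) := by
      ext y
      rw [Set.mem_preimage, Set.mem_Iic, Set.mem_Ici, ← sub_nonneg (b := b * (x - m)), ← hiff,
        ← neg_mul_neg b (_ - x), mul_nonneg_iff_of_pos_left (neg_pos.2 h), neg_nonneg, sub_nonpos]
    rw [hpre, measureReal_gammaMeasure_one ha measurableSet_Ici, ← Set.Ioi_inter_Ioi]
    congr 1
    exact setIntegral_congr_set ((ae_eq_refl _).inter Ioi_ae_eq_Ici.symm)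
  · rw [if_neg h.not_gt, lowerGamma]
    have hpre : (fun y => b⁻¹ * y + m) ⁻¹' Set.Iic x = Set.Iic (b * (x - m)) := by
      ext y
      rw [Set.mem_preimage, Set.mem_Iic, Set.mem_Iic, ← sub_nonpos (b := b * (x - m)), ← hiff,
        ← neg_nonneg, ← mul_neg, mul_nonneg_iff_of_pos_left h, neg_nonneg, sub_nonpos]
    rw [hpre, measureReal_gammaMeasure_one ha measurableSet_Iic]
    congr 2
    congr 1
    ext y
    simp only [Set.mem_inter_iff, Set.mem_Ioi, Set.mem_Iic, Set.mem_Ioc, le_max_iff]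
    grind

/-! ### Characteristic functions -/

open Complex in
lemma integrableOn_pow_mul_cexp {r : ℂ} (hr : 0 < r.re) (n : ℕ) :
    IntegrableOn (fun y : ℝ => (y : ℂ) ^ n * cexp (-(r * y))) (Set.Ioi 0) := by
  have h := integrableOn_rpow_mul_exp_neg_mul_rpow (p := 1) (s := n) (b := r.re)
    (by linarith [n.cast_nonneg (α := ℝ)]) one_pos hr
  refine Integrable.mono' h (by fun_prop) ((ae_restrict_iff' measurableSet_Ioi).2
    (Filter.Eventually.of_forall fun y (hy : 0 < y) => ?_))
  simp [Complex.norm_exp, abs_of_pos hy]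

-- Integration by parts, with `y ^ (n + 1) * exp (-r y)` vanishing at both ends. Integer shapes keep
-- all complex powers integral.
open Complex in
lemma integral_pow_mul_cexp {r : ℂ} (hr : 0 < r.re) (n : ℕ) :
    ∫ y : ℝ in Set.Ioi 0, (y : ℂ) ^ n * cexp (-(r * y)) = n.factorial / r ^ (n + 1) := by
  have hr0 : r ≠ 0 := fun h => by simp [h] at hr
  induction n with
  | zero =>
    have := integral_exp_mul_complex_Ioi (a := -r) (by simpa using hr) 0
    simpa [neg_mul, neg_div] using this
  | succ n ih =>
    have hderiv : ∀ y : ℝ, HasDerivAt (fun y : ℝ => (y : ℂ) ^ (n + 1) * cexp (-(r * y)))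
        (((n : ℂ) + 1) * ((y : ℂ) ^ n * cexp (-(r * y)))
          - r * ((y : ℂ) ^ (n + 1) * cexp (-(r * y)))) y := by
      intro y
      have h1 : HasDerivAt (fun y : ℂ => y ^ (n + 1) * cexp (-(r * y)))
          (((n : ℂ) + 1) * ((y : ℂ) ^ n * cexp (-(r * y)))
          - r * ((y : ℂ) ^ (n + 1) * cexp (-(r * y)))) (y : ℂ) := by
        have := (hasDerivAt_pow (n + 1) (y : ℂ)).mul
          (((hasDerivAt_id (y : ℂ)).const_mul r).neg.cexp)
        refine (this.congr_deriv ?_)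
        simp
        ring
      exact h1.comp_ofReal
    have hlim : Filter.Tendsto (fun y : ℝ => (y : ℂ) ^ (n + 1) * cexp (-(r * y)))
        Filter.atTop (nhds 0) := by
      rw [tendsto_zero_iff_norm_tendsto_zero]
      refine (tendsto_rpow_mul_exp_neg_mul_atTop_nhds_zero (n + 1 : ℕ) r.re hr).congr' ?_
      filter_upwards [Filter.eventually_gt_atTop 0] with y hy
      rw [Real.rpow_natCast]
      simp [Complex.norm_exp, abs_of_pos hy]
    have hI := integrableOn_pow_mul_cexp hr n
    have hI1 := integrableOn_pow_mul_cexp hr (n + 1)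
    have hftc := integral_Ioi_of_hasDerivAt_of_tendsto'
      (fun y (_ : y ∈ Set.Ici (0 : ℝ)) => hderiv y)
      ((hI.const_mul _).sub (hI1.const_mul _)) hlim
    rw [integral_sub (hI.const_mul _) (hI1.const_mul _), integral_const_mul, integral_const_mul,
      ih] at hftc
    simp only [ofReal_zero, ne_eq, Nat.add_eq_zero_iff, one_ne_zero, and_false, not_false_eq_true,
      zero_pow, zero_mul, sub_zero] at hftc
    rw [eq_div_iff (pow_ne_zero _ hr0), pow_succ, ← mul_assoc, mul_right_comm, mul_comm _ r,
      ← sub_eq_zero.1 hftc, Nat.factorial_succ]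
    push_cast
    field_simp

open Complex in
lemma charFun_gammaMeasure_one {a : ℕ} (ha : 0 < a) (t : ℝ) :
    charFun (gammaMeasure a 1) t = (1 / (1 - t * I)) ^ a := by
  obtain ⟨n, rfl⟩ := Nat.exists_eq_succ_of_ne_zero ha.ne'
  have hre : 0 < (1 - t * I : ℂ).re := by simp
  rw [charFun_apply_real, integral_gammaMeasure_one (by positivity), Nat.cast_succ,
    Real.Gamma_nat_eq_factorial, add_sub_cancel_right,
    setIntegral_congr_fun (g := fun y : ℝ => (y : ℂ) ^ n * cexp (-((1 - t * I) * y)))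
      measurableSet_Ioi, integral_pow_mul_cexp hre, one_div, inv_pow, div_eq_mul_inv,
    Complex.real_smul, ← mul_assoc]
  · push_cast
    rw [inv_mul_cancel₀ (by exact_mod_cast n.factorial_ne_zero), one_mul]
  · intro y _
    dsimp only
    rw [Complex.real_smul, Real.rpow_natCast]
    push_cast
    rw [mul_assoc, ← Complex.exp_add]
    congr 2
    ring

open Complex in
lemma charFun_pearsonMeasure {a : ℕ} {b : ℝ} (m : ℝ) (ha : 0 < a) (hb : b ≠ 0) (t : ℝ) :
    charFun (pearsonMeasure a b m) t = ((b : ℂ) / (b + -(t * I))) ^ a * cexp (m * t * I) := by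
  have hcomp : (gammaMeasure a 1).map (fun y => b⁻¹ * y + m)
      = ((gammaMeasure a 1).map (b⁻¹ * ·)).map (· + m) := by
    rw [Measure.map_map (by fun_prop) (by fun_prop)]
    rfl
  have hb' : (b : ℂ) ≠ 0 := by exact_mod_cast hb
  rw [pearsonMeasure_eq_map _ m hb, hcomp, charFun_map_add_const, charFun_map_mul,
    charFun_gammaMeasure_one ha]
  congr 2
  · have h1 : (1 - ((b⁻¹ * t : ℝ) : ℂ) * I) = (b + -(t * I)) / b := by
      push_cast
      field_simp
      ring
    rw [h1, one_div_div]
  · simp [mul_comm]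

/-! ### From characteristic functions to integrals -/

/-- A finite measure whose characteristic function is a linear combination of characteristic
functions of finite measures integrates functions as that linear combination does. -/
lemma integral_eq_sum_of_charFun_eq_sum {ι : Type*} [Fintype ι] (μ : Measure ℝ)
    [IsFiniteMeasure μ] (ν : ι → Measure ℝ) [∀ i, IsFiniteMeasure (ν i)] (c : ι → ℝ)
    (h : ∀ t, charFun μ t = ∑ i, (c i : ℂ) * charFun (ν i) t) {f : ℝ → ℝ}
    (hf : ∀ i, Integrable f (ν i)) :
    Integrable f μ ∧ ∫ x, f x ∂μ = ∑ i, c i * ∫ x, f x ∂(ν i) := by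
  have hint : ∀ (d : ι → NNReal), Integrable f (∑ i, d i • ν i) := fun d =>
    integrable_finsetSum_measure.2 fun i _ => (hf i).smul_measure_nnreal
  have hcf : ∀ (d : ι → NNReal) (t : ℝ), charFun (∑ i, d i • ν i) t
      = ∑ i, ((d i : ℝ) : ℂ) * charFun (ν i) t := by
    intro d t
    simp only [charFun_apply_real]
    rw [integral_finsetSum_measure]
    · refine Finset.sum_congr rfl fun i _ => ?_
      rw [integral_smul_nnreal_measure, NNReal.smul_def, Complex.real_smul]
    · intro i _
      refine Integrable.smul_measure_nnreal ?_
      refine Integrable.of_bound (C := 1) (by fun_prop) (Filter.Eventually.of_forall fun x => ?_)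
      rw [← Complex.ofReal_mul, Complex.norm_exp_ofReal_mul_I]
  have hval : ∀ (d : ι → NNReal), ∫ x, f x ∂(∑ i, d i • ν i) = ∑ i, (d i : ℝ) * ∫ x, f x ∂(ν i) := by
    intro d
    rw [integral_finsetSum_measure fun i _ => (hf i).smul_measure_nnreal]
    exact Finset.sum_congr rfl fun i _ => by
      rw [integral_smul_nnreal_measure, NNReal.smul_def, smul_eq_mul]
  -- The coefficients may be negative. With `c = p - q` and the `q` terms moved to the side of `μ`,
  -- both sides are finite measures, and uniqueness of characteristic functions applies.
  set p : ι → NNReal := fun i => (c i).toNNReal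
  set q : ι → NNReal := fun i => (-c i).toNNReal
  have hpq : ∀ i, (p i : ℝ) - q i = c i := fun i => by
    simp only [p, q, Real.coe_toNNReal']
    exact max_zero_sub_eq_self (c i)
  have heq : μ + ∑ i, q i • ν i = ∑ i, p i • ν i := by
    refine Measure.ext_of_charFun (funext fun t => ?_)
    have hadd : charFun (μ + ∑ i, q i • ν i) t = charFun μ t + charFun (∑ i, q i • ν i) t := by
      simp only [charFun_apply_real]
      refine integral_add_measure ?_ ?_ <;>
      · refine Integrable.of_bound (C := 1) (by fun_prop) (Filter.Eventually.of_forall fun x => ?_)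
        rw [← Complex.ofReal_mul, Complex.norm_exp_ofReal_mul_I]
    rw [hadd, hcf, hcf, h, ← Finset.sum_add_distrib]
    refine Finset.sum_congr rfl fun i _ => ?_
    rw [← add_mul, ← hpq i]
    push_cast
    ring
  -- Integrability is inherited because `μ ≤ ∑ p i • ν i`.
  have hμ : Integrable f μ := by
    refine (hint p).mono_measure ?_
    rw [← heq]
    exact Measure.le_add_right le_rfl
  refine ⟨hμ, ?_⟩
  have h1 := integral_add_measure hμ (hint q)
  rw [heq, hval, hval] at h1
  rw [eq_sub_of_add_eq h1.symm, ← Finset.sum_sub_distrib]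
  exact Finset.sum_congr rfl fun i _ => by rw [← sub_mul, hpq]

/-! ### The law of the sum -/

/-- CDF and moments of a sum of `L = N + 1` independent Pearson type III random variables with
positive integer shapes and inverse scales of a common sign. -/
theorem mainTheorem6 {Ω : Type*} [MeasurableSpace Ω] (P : Measure Ω) [IsProbabilityMeasure P]
    (N : ℕ) (X : Fin (N + 1) → Ω → ℝ)
    (a : Fin (N + 1) → ℕ) (b m : Fin (N + 1) → ℝ)
    (ha : ∀ i, 0 < a i)
    (hb : (∀ i, 0 < b i) ∨ (∀ i, b i < 0))
    (hX : ∀ i, HasLaw (X i) (pearsonMeasure (a i) (b i) (m i)) P)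
    (hindep : iIndepFun X P) :
    -- the cumulative distribution function
    ((∀ β : ℝ, (∀ i, b i = β) → ∀ x : ℝ,
        cdf (P.map fun ω => ∑ i, X i ω) x
          = pearsonCDF ((∑ i, a i : ℕ) : ℝ) β (∑ i, m i) x) ∧
      ((∀ i j, i ≠ j → b i ≠ b j) → ∀ x : ℝ,
        cdf (P.map fun ω => ∑ i, X i ω) x
          = ∑ i, ∑ k ∈ Finset.Icc 1 (a i),
              Xi0 i k a b * pearsonCDF (k : ℝ) (b i) (∑ q, m q) x)) ∧
    -- the moments
    (∀ n : ℕ,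
      Integrable (fun ω => (∑ i, X i ω) ^ n) P ∧
      (∀ β : ℝ, (∀ i, b i = β) →
        ∫ ω, (∑ i, X i ω) ^ n ∂P
          = pearsonMoment n ((∑ i, a i : ℕ) : ℝ) β (∑ i, m i)) ∧
      ((∀ i j, i ≠ j → b i ≠ b j) →
        ∫ ω, (∑ i, X i ω) ^ n ∂P
          = ∑ i, ∑ k ∈ Finset.Icc 1 (a i),
              Xi0 i k a b * pearsonMoment n (k : ℝ) (b i) (∑ q, m q))) := by
  have hb0 : ∀ i, b i ≠ 0 := fun i => hb.elim (fun h => (h i).ne') (fun h => (h i).ne)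
  have hXm : ∀ i, AEMeasurable (X i) P := fun i => (hX i).aemeasurable
  have hSm : AEMeasurable (fun ω => ∑ i, X i ω) P := by fun_prop
  set μ := P.map fun ω => ∑ i, X i ω with hμ
  have : IsProbabilityMeasure μ := Measure.isProbabilityMeasure_map hSm
  have hcf : ∀ t, charFun μ t = (∏ i, ((b i : ℂ) / (b i + -(t * Complex.I))) ^ a i) *
      Complex.exp ((∑ q, m q : ℝ) * t * Complex.I) := by
    intro t
    rw [hμ, hindep.charFun_map_fun_sum_eq_prod hXm, Finset.prod_apply]
    simp only [(hX _).map_eq, charFun_pearsonMeasure _ (ha _) (hb0 _)]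
    rw [Finset.prod_mul_distrib, ← Complex.exp_sum]
    push_cast
    rw [Finset.sum_mul, Finset.sum_mul]
  have heq : ∀ β : ℝ, (∀ i, b i = β) →
      μ = pearsonMeasure ((∑ i, a i : ℕ) : ℝ) β (∑ i, m i) := by
    intro β hβ
    have hβ0 : β ≠ 0 := hβ 0 ▸ hb0 0
    have hpos : 0 < ∑ i, a i := Finset.sum_pos (fun i _ => ha i) Finset.univ_nonempty
    have := isProbabilityMeasure_pearsonMeasure (∑ i, m i)
      (Nat.cast_pos.2 hpos : (0 : ℝ) < (∑ i, a i : ℕ)) hβ0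
    refine Measure.ext_of_charFun (funext fun t => ?_)
    rw [hcf, charFun_pearsonMeasure _ hpos hβ0]
    simp only [hβ, Finset.prod_pow_eq_pow_sum]
  have hdist : (∀ i j, i ≠ j → b i ≠ b j) → ∀ f : ℝ → ℝ,
      (∀ i, ∀ k ∈ Finset.Icc 1 (a i), Integrable f (pearsonMeasure k (b i) (∑ q, m q))) →
      ∫ x, f x ∂μ = ∑ i, ∑ k ∈ Finset.Icc 1 (a i),
        Xi0 i k a b * ∫ x, f x ∂(pearsonMeasure k (b i) (∑ q, m q)) := by
    intro hne f hf
    -- Indexing by the subtype keeps `1 ≤ k` at hand, so that every component is a probability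
    -- measure.
    set s := (Finset.univ : Finset (Fin (N + 1))).sigma fun i => Finset.Icc 1 (a i)
    have hmem : ∀ p : s, p.1.2 ∈ Finset.Icc 1 (a p.1.1) := fun p => (Finset.mem_sigma.1 p.2).2
    have hpos : ∀ p : s, 0 < p.1.2 := fun p => (Finset.mem_Icc.1 (hmem p)).1
    have (p : s) : IsFiniteMeasure (pearsonMeasure p.1.2 (b p.1.1) (∑ q, m q)) := by
      have := isProbabilityMeasure_pearsonMeasure (∑ i, m i)
        (Nat.cast_pos.2 (hpos p) : (0 : ℝ) < p.1.2) (hb0 p.1.1)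
      infer_instance
    have key := (integral_eq_sum_of_charFun_eq_sum μ
      (fun p : s => pearsonMeasure p.1.2 (b p.1.1) (∑ q, m q))
      (fun p => Xi0 p.1.1 p.1.2 a b) ?_ (fun p => hf _ _ (hmem p))).2
    · rw [key, Finset.sum_coe_sort s fun p =>
        Xi0 p.1 p.2 a b * ∫ x, f x ∂(pearsonMeasure p.2 (b p.1) (∑ q, m q)), Finset.sum_sigma]
    · intro t
      simp only [charFun_pearsonMeasure _ (hpos _) (hb0 _)]
      rw [Finset.sum_coe_sort s fun p => (Xi0 p.1 p.2 a b : ℂ) *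
        (((b p.1 : ℂ) / (b p.1 + -(t * Complex.I))) ^ p.2 *
          Complex.exp ((∑ q, m q : ℝ) * t * Complex.I)), Finset.sum_sigma, hcf,
        prod_eq_sum_Xi0 a ha b hne hb0]
      · simp only [Finset.sum_mul, mul_assoc]
      -- No pole is met: `b i - it` has real part `b i ≠ 0`.
      · intro i h
        have := congrArg Complex.re h
        simp [hb0 i] at this
  have hdist_Iic : (∀ i j, i ≠ j → b i ≠ b j) → ∀ x : ℝ,
      μ.real (Set.Iic x) = ∑ i, ∑ k ∈ Finset.Icc 1 (a i),
        Xi0 i k a b * pearsonCDF (k : ℝ) (b i) (∑ q, m q) x := by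
    intro hne x
    have hk : ∀ i, ∀ k ∈ Finset.Icc 1 (a i), (0 : ℝ) < k := fun i k hk =>
      Nat.cast_pos.2 (Finset.mem_Icc.1 hk).1
    rw [← integral_indicator_one measurableSet_Iic, hdist hne]
    · refine Finset.sum_congr rfl fun i _ => Finset.sum_congr rfl fun k hk' => ?_
      rw [integral_indicator_one measurableSet_Iic,
        measureReal_Iic_pearsonMeasure _ (hk i k hk') (hb0 i)]
    · intro i k hk'
      have := isProbabilityMeasure_pearsonMeasure (∑ i, m i) (hk i k hk') (hb0 i)
      exact (integrable_const (1 : ℝ)).indicator measurableSet_Iic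
  have hmap : ∀ n : ℕ, ∫ ω, (∑ i, X i ω) ^ n ∂P = ∫ x, x ^ n ∂μ := fun n =>
    (integral_map hSm (by fun_prop : AEStronglyMeasurable (fun x : ℝ => x ^ n) μ)).symm
  refine ⟨⟨fun β hβ x => ?_, fun hne x => ?_⟩, fun n => ⟨?_, fun β hβ => ?_, fun hne => ?_⟩⟩
  · have hpos : 0 < ∑ i, a i := Finset.sum_pos (fun i _ => ha i) Finset.univ_nonempty
    rw [cdf_eq_real, heq β hβ,
      measureReal_Iic_pearsonMeasure _ (Nat.cast_pos.2 hpos) (hβ 0 ▸ hb0 0)]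
  · rw [cdf_eq_real, hdist_Iic hne]
  · rcases eq_or_ne n 0 with rfl | hn
    · simp
    -- Integrability is claimed also when the `b i` are neither equal nor distinct, so it rests on
    -- `L^n` being closed under sums, not on an explicit law.
    have hmem : ∀ i, MemLp (X i) n P := by
      intro i
      have hint : Integrable (fun x : ℝ => x ^ n) (P.map (X i)) :=
        (hX i).map_eq ▸ integrable_pow_pearsonMeasure _ (Nat.cast_pos.2 (ha i)) (hb0 i) n
      rw [integrable_map_measure (by fun_prop) (hXm i)] at hint
      rw [← integrable_norm_rpow_iff (hXm i).aestronglyMeasurable (by exact_mod_cast hn)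
        (ENNReal.natCast_ne_top n)]
      simpa [Function.comp_def] using hint.norm
    have hsum := (memLp_finsetSum Finset.univ fun i _ => hmem i).integrable_norm_pow hn
    rw [← integrable_norm_iff (by fun_prop)]
    simpa using hsum
  · have hpos : 0 < ∑ i, a i := Finset.sum_pos (fun i _ => ha i) Finset.univ_nonempty
    rw [hmap, heq β hβ, integral_pow_pearsonMeasure _ (Nat.cast_pos.2 hpos) (hβ 0 ▸ hb0 0)]
  · rw [hmap, hdist hne]
    · refine Finset.sum_congr rfl fun i _ => Finset.sum_congr rfl fun k hk => ?_
      rw [integral_pow_pearsonMeasure _ (Nat.cast_pos.2 (Finset.mem_Icc.1 hk).1) (hb0 i)]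
    · exact fun i k hk => integrable_pow_pearsonMeasure _
        (Nat.cast_pos.2 (Finset.mem_Icc.1 hk).1) (hb0 i) n
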